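/- Let $G=(G_n)_{n\ge 0}$ be a numeration system, i.e. a strictly increasing sequence of positive integers with $G_0=1$, that is generated by the linear recurrence of order $d\ge 1$ $$G_{n+d}=a_0G_{n+d-1}+a_1G_{n+d-2}+\dots+a_{d-1}G_n\quad(n\ge 0),\qquad G_0=1,\quad G_{n+1}=\sum_{k=0}^{n}a_{n-k}G_k+1\quad(n+1<d),$$ and assume that $a_0=\dots=a_{d-1}=a$ for a positive integer $a$. Let $\beta$ be the characteristic root, i.e. the positive root of $x^d=a_0x^{d-1}+\dots+a_{d-1}$. Let $\mathcal K_G$ be the set of all sequences $\varepsilon=(\varepsilon_k)_{k\ge0}$ of nonnegative integers with $\sum_{k<K}\varepsilon_kG_k<G_K$ for all $K\ge 0$, with the product topology and its Borel $\sigma$-algebra. Let $\tau\colon\mathcal K_G\to\mathcal K_G$ be the odometer: put $x(j)=\sum_{k\le j}x_kG_k$; if there is $M$ with $x(j)<G_{j+1}-1$ for all $j\ge M$, then $\tau(x)=\varepsilon_0(x(j)+1)\dots\varepsilon_j(x(j)+1)\,x_{j+1}x_{j+2}\dots$ for any such $j\geq M$, where $\varepsilon_i(n)$ are the digits of the greedy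 $G$-expansion $n=\sum_i\varepsilon_i(n)G_i$; otherwise $\tau(x)=0^\infty$. Let $\phi_\beta\colon\mathcal K_G\to[0,\infty)$, $\phi_\beta(x)=\sum_{j\ge0}x_j\beta^{-j-1}$, be the $\beta$-adic Monna map, and let $\lambda$ be Lebesgue measure on $\mathbb R$. Then $\tau$ has a unique invariant Borel probability measure $\mu$ on $\mathcal K_G$, and for every cylinder set $Z=\{x\in\mathcal K_G : x_0=w_0,\dots,x_{k-1}=w_{k-1}\}$ (with $k\ge 0$ and nonnegative integers $w_0,\dots,w_{k-1}$) the set $\phi_\beta(Z)$ is Borel and $$\mu(Z)=\lambda(\phi_\beta(Z)).$$ -/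

import Mathlib

open MeasureTheory

/-- A numeration system: a strictly increasing sequence `G 0 < G 1 < ...` of positive integers
with `G 0 = 1`. -/
structure NumerationSystem where
  /-- the base sequence -/
  G : ℕ → ℕ
  zero' : G 0 = 1
  strictMono' : StrictMono G

namespace NumerationSystem

variable (N : NumerationSystem)

/-- The value `∑_{k < K} ε_k G_k` of the first `K` digits of a digit sequence. -/
def partialSum (ε : ℕ → ℕ) (K : ℕ) : ℕ := ∑ k ∈ Finset.range K, ε k * N.G k

/-- The compactification `𝒦_G`: the set of all admissible digit sequences, that is, of all
`ε = ε_0 ε_1 ...` with `∑_{k < K} ε_k G_k < G_K` for every `K`. The digit bound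
`ε_k ≤ ⌈G_{k+1} / G_k⌉ - 1` follows, see `digit_mul_lt`. As a subtype of `ℕ → ℕ` it carries the
product topology and its Borel `σ`-algebra (the one generated by the cylinder sets). -/
def K : Set (ℕ → ℕ) := {ε | ∀ K, N.partialSum ε K < N.G K}

theorem digit_mul_lt {ε : ℕ → ℕ} (h : ε ∈ N.K) (k : ℕ) : ε k * N.G k < N.G (k + 1) := by
  have h1 := h (k + 1)
  rw [partialSum, Finset.sum_range_succ] at h1
  omega

/-- Greedy algorithm on the positions `j - 1, j - 2, ..., 0`: `digitsBelow j n m` is the digit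
at position `m` (and `0` for `m ≥ j`). For `n < G j` this is the full greedy expansion of `n`. -/
def digitsBelow : ℕ → ℕ → ℕ → ℕ
  | 0, _, _ => 0
  | j + 1, n, m => if m = j then n / N.G j else digitsBelow j (n % N.G j) m

/-- The digits `ε_0(n), ε_1(n), ...` of the greedy `G`-expansion of the natural number `n`
(note that `n < G n`, so all nonzero digits are at positions below `n`). -/
def expansion (n : ℕ) : ℕ → ℕ := N.digitsBelow n n

theorem lt_G (n : ℕ) : n < N.G n := by
  induction n with
  | zero => rw [N.zero']; exact Nat.one_pos
  | succ n ih => exact lt_of_le_of_lt ih (N.strictMono' (Nat.lt_succ_self n))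

theorem digitsBelow_succ_of_lt {j n : ℕ} (h : n < N.G j) :
    N.digitsBelow (j + 1) n = N.digitsBelow j n := by
  funext m
  have hz : ∀ (i n m : ℕ), i ≤ m → N.digitsBelow i n m = 0 := by
    intro i
    induction i with
    | zero => intro n m _; rfl
    | succ i ih =>
      intro n m him
      rw [digitsBelow, if_neg (by omega), ih _ _ (by omega)]
  rw [digitsBelow]
  split_ifs with hm
  · rw [Nat.div_eq_of_lt h, hz _ _ _ hm.ge]
  · rw [Nat.mod_eq_of_lt h]

theorem digitsBelow_of_le {i j n : ℕ} (h : n < N.G i) (hij : i ≤ j) :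
    N.digitsBelow j n = N.digitsBelow i n := by
  induction j, hij using Nat.le_induction with
  | base => rfl
  | succ j hij ih =>
    rw [N.digitsBelow_succ_of_lt (lt_of_lt_of_le h (N.strictMono'.monotone hij)), ih]

theorem expansion_eq {j n : ℕ} (h : n < N.G j) : N.expansion n = N.digitsBelow j n := by
  rcases le_total n j with hj | hj
  · exact (N.digitsBelow_of_le (N.lt_G n) hj).symm
  · exact N.digitsBelow_of_le h hj

theorem expansion_apply {j n : ℕ} (h : n < N.G (j + 1)) (m : ℕ) :
    N.expansion n m = if m = j then n / N.G j else N.expansion (n % N.G j) m := by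
  have hp : 0 < N.G j := lt_of_le_of_lt (Nat.zero_le _) (N.lt_G j)
  rw [N.expansion_eq h, N.expansion_eq (Nat.mod_lt n hp)]
  rfl

theorem partialSum_expansion_aux (j : ℕ) : ∀ n, n < N.G j →
    N.partialSum (N.expansion n) j = n ∧
      ∀ K, K ≤ j → N.partialSum (N.expansion n) K < N.G K := by
  induction j with
  | zero =>
    intro n hn
    rw [N.zero'] at hn
    refine ⟨by simp only [partialSum, Finset.range_zero, Finset.sum_empty]; omega, ?_⟩
    intro K hK
    obtain rfl : K = 0 := by omega
    simp [partialSum, N.zero']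
  | succ j ih =>
    intro n hn
    have hp : 0 < N.G j := lt_of_le_of_lt (Nat.zero_le _) (N.lt_G j)
    obtain ⟨h1, h2⟩ := ih (n % N.G j) (Nat.mod_lt n hp)
    have hlow : ∀ K, K ≤ j →
        N.partialSum (N.expansion n) K = N.partialSum (N.expansion (n % N.G j)) K := by
      intro K hK
      refine Finset.sum_congr rfl fun m hm => ?_
      rw [Finset.mem_range] at hm
      rw [N.expansion_apply hn, if_neg (by omega)]
    have htop : N.partialSum (N.expansion n) (j + 1) = n := by
      have := hlow j le_rfl
      rw [h1] at this
      rw [partialSum, Finset.sum_range_succ]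
      rw [partialSum] at this
      rw [this, N.expansion_apply hn, if_pos rfl]
      exact Nat.mod_add_div' n (N.G j)
    refine ⟨htop, fun K hK => ?_⟩
    rcases Nat.lt_or_ge j K with h | h
    · obtain rfl : K = j + 1 := by omega
      rw [htop]; exact hn
    · rw [hlow K h]; exact h2 K h

/-- The set `𝒦_G^0` of those `x` for which some `M` satisfies
`∑_{k ≤ j} x_k G_k < G_{j+1} - 1` for all `j ≥ M`; the predicate fixes `M`. -/
def NoCarryFrom (x : ℕ → ℕ) (M : ℕ) : Prop :=
  ∀ j, M ≤ j → N.partialSum x (j + 1) + 1 < N.G (j + 1)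

/-- The digit sequence `ε_0(x(j)+1) ... ε_j(x(j)+1) x_{j+1} x_{j+2} ...`, where
`x(j) = ∑_{k ≤ j} x_k G_k`. -/
def addOneAt (x : ℕ → ℕ) (j : ℕ) : ℕ → ℕ := fun m =>
  if m ≤ j then N.expansion (N.partialSum x (j + 1) + 1) m else x m

theorem addOneAt_succ {x : ℕ → ℕ} {j : ℕ} (h : N.partialSum x (j + 1) + 1 < N.G (j + 1))
    (h' : N.partialSum x (j + 2) + 1 < N.G (j + 2)) :
    N.addOneAt x (j + 1) = N.addOneAt x j := by
  funext m
  have hs : N.partialSum x (j + 2) + 1 =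
      N.partialSum x (j + 1) + 1 + x (j + 1) * N.G (j + 1) := by
    rw [partialSum, Finset.sum_range_succ, partialSum]; omega
  have hp : 0 < N.G (j + 1) := lt_of_le_of_lt (Nat.zero_le _) (N.lt_G _)
  simp only [addOneAt]
  rcases Nat.lt_trichotomy m (j + 1) with hm | hm | hm
  · rw [if_pos (by omega), if_pos (by omega), N.expansion_apply h', if_neg (by omega), hs,
      Nat.add_mul_mod_self_right, Nat.mod_eq_of_lt h]
  · rw [if_pos (by omega), if_neg (by omega), N.expansion_apply h', if_pos hm, hs,
      Nat.add_mul_div_right _ _ hp, Nat.div_eq_of_lt h, hm, Nat.zero_add]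
  · rw [if_neg (by omega), if_neg (by omega)]

/-- The sequence `addOneAt x j` does not depend on the choice of `j ≥ M`. -/
theorem addOneAt_eq {x : ℕ → ℕ} {M : ℕ} (h : N.NoCarryFrom x M) {j : ℕ} (hj : M ≤ j) :
    N.addOneAt x j = N.addOneAt x M := by
  induction j, hj using Nat.le_induction with
  | base => rfl
  | succ j hj ih => rw [N.addOneAt_succ (h j hj) (h (j + 1) (by omega)), ih]

theorem addOneAt_mem {x : ℕ → ℕ} {M : ℕ} (h : N.NoCarryFrom x M) : N.addOneAt x M ∈ N.K := by
  intro K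
  rw [← N.addOneAt_eq h (le_max_left M K)]
  set j := max M K with hj
  have hK : K ≤ j + 1 := by have := le_max_right M K; omega
  have := (N.partialSum_expansion_aux (j + 1) _ (h j (le_max_left M K))).2 K hK
  refine lt_of_eq_of_lt (Finset.sum_congr rfl fun m hm => ?_) this
  rw [Finset.mem_range] at hm
  rw [addOneAt, if_pos (by omega)]

theorem zero_mem : (fun _ => 0 : ℕ → ℕ) ∈ N.K := by
  intro K
  simpa [partialSum] using lt_of_le_of_lt (Nat.zero_le _) (N.lt_G K)

open Classical in
/-- The odometer `τ : 𝒦_G → 𝒦_G`: addition of one on `𝒦_G^0`, and `τ x = 0^∞` elsewhere. -/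
noncomputable def odometer (x : N.K) : N.K :=
  if h : ∃ M, N.NoCarryFrom x M then
    ⟨N.addOneAt x (Classical.choose h), N.addOneAt_mem (Classical.choose_spec h)⟩
  else ⟨fun _ => 0, N.zero_mem⟩

/-- The cylinder set of the sequences whose first `k` digits are `w 0, ..., w (k - 1)`. -/
def cylinder {k : ℕ} (w : Fin k → ℕ) : Set N.K := {x | ∀ i : Fin k, x.1 i = w i}

/-- The `β`-adic Monna map `φ_β(ε) = ∑_j ε_j β^{-j-1}`. -/
noncomputable def monna (β : ℝ) (x : N.K) : ℝ := ∑' j : ℕ, (x.1 j : ℝ) / β ^ (j + 1)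

/-- `G` is generated by the linear recurrence of order `d` with coefficients
`c 0, ..., c (d - 1)`, i.e. `G_{n+d} = c_0 G_{n+d-1} + ... + c_{d-1} G_n` for all `n ≥ 0`, with
initial values `G_0 = 1` and `G_{n+1} = c_0 G_n + ... + c_n G_0 + 1` for `n + 1 < d`. -/
def IsLinearRecurrence (d : ℕ) (c : ℕ → ℕ) : Prop :=
  (∀ n, n + 1 < d → N.G (n + 1) = ∑ k ∈ Finset.range (n + 1), c (n - k) * N.G k + 1) ∧
    ∀ n, N.G (n + d) = ∑ j ∈ Finset.range d, c j * N.G (n + (d - 1 - j))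

end NumerationSystem

/-- `β` is the characteristic root of the recurrence of order `d` with coefficients
`c 0, ..., c (d - 1)`: the positive root of `x^d = c_0 x^{d-1} + ... + c_{d-1}`. (As the
coefficients are nonnegative, there is at most one positive root, and it is the dominant one.) -/
def IsCharacteristicRoot (d : ℕ) (c : ℕ → ℕ) (β : ℝ) : Prop :=
  0 < β ∧ β ^ d = ∑ j ∈ Finset.range d, (c j : ℝ) * β ^ (d - 1 - j)

/-- `μ` is the unique invariant probability measure of `T`. -/
def IsUniqueInvariantMeasure {X : Type*} [MeasurableSpace X] (T : X → X) (μ : Measure X) : Prop :=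
  IsProbabilityMeasure μ ∧ MeasurePreserving T μ μ ∧
    ∀ ν : Measure X, IsProbabilityMeasure ν → MeasurePreserving T ν ν → ν = μ

/-! Admissibility means: digits at most `a`, and never `d` consecutive digits `a`. A digit below `a`
therefore decouples what precedes it from what follows. Call free set of length `s` the sequences
with a given admissible prefix of length `s` followed by a digit below `a`. Exchanging prefixes
shows that the odometer pulls a free set with nonzero prefix back to the free set whose prefix has
value one less (`preimage_freeSet`).

Uniqueness: an invariant measure gives all free sets of length `s` one mass `q s`. Splitting by the
digit at `s` and by the run of digits `a` after it gives `q s = a * ∑_{m<d} q (s+1+m)`, and likewise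
`∑_{m<d} q m = 1`. Since `∑_{i<d} a/β^(i+1) = 1`, each `q s * β^s` is a convex combination of the
next `d` such terms; a nonnegative sequence of this kind is constant, so `q s = a/β^(s+1)`. Free
sets with nonzero prefix generate the σ-algebra.

Existence: push Lebesgue measure on `[0,1)` forward along the greedy `β`-expansion, a section of the
Monna map. Then `μ A ≤ λ(φ A)`, while the image of a free set lies in an interval of length
`a/β^(s+1)`. These upper bounds add up exactly along partitions into free sets, so they are
equalities, and `μ` is invariant. A cylinder is a finite disjoint union of free sets, whence also
`λ(φ Z) ≤ μ Z`. -/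

namespace NumerationSystem

variable {N : NumerationSystem}

/-- The base sequence satisfies the linear recurrence of order `d` with all coefficients equal
to `a`, including the canonical initial values. -/
structure ConstRec (N : NumerationSystem) (d a : ℕ) : Prop where
  one_le_d : 1 ≤ d
  one_le_a : 1 ≤ a
  init : ∀ n, n + 1 < d → N.G (n + 1) = a * ∑ k ∈ Finset.range (n + 1), N.G k + 1
  step : ∀ n, N.G (n + d) = a * ∑ j ∈ Finset.range d, N.G (n + j)

theorem IsLinearRecurrence.constRec {d : ℕ} (hd : 1 ≤ d) {c : ℕ → ℕ} {a : ℕ} (ha : 1 ≤ a)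
    (hc : ∀ j, j < d → c j = a) (hG : N.IsLinearRecurrence d c) : N.ConstRec d a where
  one_le_d := hd
  one_le_a := ha
  init n hn := by
    rw [hG.1 n hn, Finset.mul_sum]
    congr 1
    refine Finset.sum_congr rfl fun k hk => ?_
    rw [hc _ (by omega)]
  step n := by
    rw [hG.2 n, Finset.mul_sum, ← Finset.sum_range_reflect]
    refine Finset.sum_congr rfl fun k hk => ?_
    rw [Finset.mem_range] at hk
    rw [hc _ (by omega)]
    congr 2
    omega

/-! ### Prefixes and their values -/

theorem G_pos (n : ℕ) : 0 < N.G n := lt_of_le_of_lt (Nat.zero_le _) (N.lt_G n)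

theorem partialSum_succ (x : ℕ → ℕ) (k : ℕ) :
    N.partialSum x (k + 1) = N.partialSum x k + x k * N.G k :=
  Finset.sum_range_succ _ _

theorem partialSum_add (x : ℕ → ℕ) (k i : ℕ) :
    N.partialSum x (k + i) =
      N.partialSum x k + ∑ l ∈ Finset.range i, x (k + l) * N.G (k + l) :=
  Finset.sum_range_add _ _ _

theorem partialSum_congr {x y : ℕ → ℕ} {k : ℕ} (h : ∀ i < k, x i = y i) :
    N.partialSum x k = N.partialSum y k :=
  Finset.sum_congr rfl fun i hi => by rw [h i (Finset.mem_range.1 hi)]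

theorem eq_of_partialSum_eq {x y : ℕ → ℕ} (hx : x ∈ N.K) (hy : y ∈ N.K) {k : ℕ}
    (h : N.partialSum x k = N.partialSum y k) : ∀ i < k, x i = y i := by
  induction k with
  | zero => intro i hi; omega
  | succ k ih =>
    rw [partialSum_succ, partialSum_succ] at h
    have hp := N.G_pos k
    have hxk : x k = y k := by
      have := congrArg (· / N.G k) h
      simpa only [Nat.add_mul_div_right _ _ hp, Nat.div_eq_of_lt (hx k),
        Nat.div_eq_of_lt (hy k), Nat.zero_add] using this
    intro i hi
    rcases Nat.lt_succ_iff_lt_or_eq.1 hi with h' | rfl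
    · exact ih (by rw [hxk] at h; omega) i h'
    · exact hxk

theorem eq_of_eventually_partialSum_eq {x y : ℕ → ℕ} (hx : x ∈ N.K) (hy : y ∈ N.K) {J : ℕ}
    (h : ∀ k, J ≤ k → N.partialSum x k = N.partialSum y k) : x = y := by
  funext i
  exact eq_of_partialSum_eq hx hy (h (max J (i + 1)) (le_max_left _ _)) i
    (lt_of_lt_of_le (Nat.lt_succ_self i) (le_max_right _ _))

theorem expansion_mem (n : ℕ) : N.expansion n ∈ N.K := fun k =>
  (N.partialSum_expansion_aux (max k n) n
    (lt_of_lt_of_le (N.lt_G n) (N.strictMono'.monotone (le_max_right _ _)))).2 k (le_max_left _ _)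

theorem partialSum_expansion {n k : ℕ} (h : n < N.G k) : N.partialSum (N.expansion n) k = n :=
  (N.partialSum_expansion_aux k n h).1

/-! ### Combinatorics of admissible sequences -/

/-- A prefix of a sequence bounded by `a` either consists of digits `a` only, or ends in a digit
smaller than `a` followed by a run of digits `a`. -/
theorem run_decomp {a : ℕ} {x : ℕ → ℕ} (hx : ∀ j, x j ≤ a) (k : ℕ) :
    (∀ l < k, x l = a) ∨ ∃ n i, k = n + 1 + i ∧ x n < a ∧ ∀ l < i, x (n + 1 + l) = a := by
  induction k with
  | zero => left; intro l hl; omega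
  | succ k ih =>
    rcases (hx k).lt_or_eq with h | h
    · exact Or.inr ⟨k, 0, rfl, h, fun l hl => by omega⟩
    · rcases ih with ih | ⟨n, i, rfl, hn, hi⟩
      · left
        intro l hl
        rcases Nat.lt_succ_iff_lt_or_eq.1 hl with h' | rfl
        exacts [ih l h', h]
      · refine Or.inr ⟨n, i + 1, rfl, hn, fun l hl => ?_⟩
        rcases Nat.lt_succ_iff_lt_or_eq.1 hl with h' | rfl
        exacts [hi l h', h]

namespace ConstRec

variable {d a : ℕ} (H : N.ConstRec d a)
include H

/-- Drop the lowest terms from the initial condition or from the recurrence for `G (k + i)`. -/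
theorem mul_sum_le (k : ℕ) {i : ℕ} (hi : i ≤ d) (hi0 : 1 ≤ i) :
    a * ∑ l ∈ Finset.range i, N.G (k + l) ≤ N.G (k + i) := by
  rcases Nat.lt_or_ge (k + i) d with h | h
  · have h1 := H.init (k + i - 1) (by omega)
    rw [show k + i - 1 + 1 = k + i by omega] at h1
    rw [h1, Finset.sum_range_add, Nat.mul_add]
    omega
  · have h1 := H.step (k + i - d)
    rw [show k + i - d + d = k + i by omega] at h1
    rw [h1]
    refine Nat.mul_le_mul_left _ ?_
    conv_rhs => rw [show d = (d - i) + i by omega, Finset.sum_range_add]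
    refine le_trans (le_of_eq ?_) (Nat.le_add_left _ _)
    refine Finset.sum_congr rfl fun l _ => ?_
    congr 1
    omega

theorem G_succ_le (k : ℕ) : N.G (k + 1) ≤ (a + 1) * N.G k := by
  have hd := H.one_le_d
  rcases Nat.lt_or_ge (k + 1) d with h | h
  · rw [H.init k h, Finset.sum_range_succ]
    rcases k with _ | k
    · simp [N.zero']
    · rw [Nat.mul_add, Nat.add_right_comm, ← H.init k (by omega)]
      linarith
  · have h1 := H.step (k + 1 - d)
    rw [show k + 1 - d + d = k + 1 by omega] at h1
    rw [h1]
    obtain ⟨e, rfl⟩ : ∃ e, d = e + 1 := ⟨d - 1, by omega⟩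
    rw [Finset.sum_range_succ, show k + 1 - (e + 1) + e = k by omega, Nat.mul_add, Nat.add_mul,
      Nat.one_mul, Nat.add_comm]
    refine Nat.add_le_add_left ?_ _
    rcases Nat.eq_zero_or_pos e with rfl | he
    · simp
    · have := H.mul_sum_le (k - e) (i := e) (by omega) he
      rw [show k - e + e = k by omega] at this
      rw [show k + 1 - (e + 1) = k - e by omega]
      exact this

/-- A digit sequence is admissible iff its digits are at most `a` and no `d` consecutive digits
are equal to `a`. -/
theorem mem_K_iff {x : ℕ → ℕ} :
    x ∈ N.K ↔ (∀ j, x j ≤ a) ∧ ∀ j, ∃ i < d, x (j + i) < a := by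
  constructor
  · intro hx
    have h1 : ∀ j, x j ≤ a := by
      intro j
      by_contra! hj
      have h2 := digit_mul_lt N hx j
      have h3 := H.G_succ_le j
      have h4 : (a + 1) * N.G j ≤ x j * N.G j := Nat.mul_le_mul_right _ hj
      omega
    refine ⟨h1, fun j => ?_⟩
    by_contra! hj
    have h2 := hx (j + d)
    rw [partialSum_add, H.step, Finset.mul_sum] at h2
    have h3 : ∑ l ∈ Finset.range d, a * N.G (j + l) ≤
        ∑ l ∈ Finset.range d, x (j + l) * N.G (j + l) :=
      Finset.sum_le_sum fun l hl => Nat.mul_le_mul_right _ (hj l (Finset.mem_range.1 hl))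
    omega
  · rintro ⟨h1, h2⟩ k
    induction k using Nat.strong_induction_on with
    | _ k ih =>
    -- A prefix of digits `a` only is covered by the initial values. Otherwise the last digit below
    -- `a`, at `n`, can be raised by one, which pays for all lower digits; the resulting block of
    -- digits `a` is bounded by `mul_sum_le`.
    rcases run_decomp h1 k with h | ⟨n, i, rfl, hn, hi⟩
    · have hk : k < d := by
        by_contra! hk
        obtain ⟨i, hi, h3⟩ := h2 0
        rw [Nat.zero_add, h i (by omega)] at h3
        exact lt_irrefl _ h3
      rcases k with _ | k
      · exact N.G_pos 0
      rw [H.init k hk, partialSum, Finset.mul_sum]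
      refine Nat.lt_succ_of_le (Finset.sum_le_sum fun l hl => ?_)
      rw [h l (Finset.mem_range.1 hl)]
    · have hid : i < d := by
        by_contra! hk
        obtain ⟨i', hi', h3⟩ := h2 (n + 1)
        rw [hi i' (by omega)] at h3
        exact lt_irrefl _ h3
      have h3 := H.mul_sum_le n (i := i + 1) hid (by omega)
      rw [show n + (i + 1) = n + 1 + i by omega] at h3
      refine lt_of_lt_of_le ?_ h3
      rw [partialSum_add, partialSum_succ, Finset.sum_range_succ', Nat.mul_add, Finset.mul_sum]
      have h4 : ∑ l ∈ Finset.range i, x (n + 1 + l) * N.G (n + 1 + l) =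
          ∑ l ∈ Finset.range i, a * N.G (n + (l + 1)) := by
        refine Finset.sum_congr rfl fun l hl => ?_
        rw [hi l (Finset.mem_range.1 hl), show n + 1 + l = n + (l + 1) by omega]
      rw [h4, Nat.add_zero]
      have h5 := ih n (by omega)
      have h6 : (x n + 1) * N.G n ≤ a * N.G n := Nat.mul_le_mul_right _ hn
      rw [Nat.add_mul, Nat.one_mul] at h6
      omega

/-- Replacing a prefix that is followed by a digit smaller than `a` by another admissible prefix
gives an admissible sequence. -/
theorem splice_mem {z x : ℕ → ℕ} (hz : z ∈ N.K) (hx : x ∈ N.K) {s : ℕ} (hs : x s < a) :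
    (fun i => if i < s then z i else x i) ∈ N.K := by
  rw [H.mem_K_iff] at hz hx ⊢
  refine ⟨fun j => ?_, fun j => ?_⟩
  · split_ifs
    exacts [hz.1 j, hx.1 j]
  · by_cases h1 : s < j
    · obtain ⟨i, hi, h⟩ := hx.2 j
      exact ⟨i, hi, by rwa [if_neg (by omega)]⟩
    · by_cases h2 : s < j + d
      · exact ⟨s - j, by omega, by rwa [if_neg (by omega), show j + (s - j) = s by omega]⟩
      · obtain ⟨i, hi, h⟩ := hz.2 j
        exact ⟨i, hi, by rwa [if_pos (by omega)]⟩

end ConstRec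

/-! ### The odometer on free sets -/

theorem odometer_spec {x : N.K} {M : ℕ} (h : N.NoCarryFrom x M) :
    ∃ J, ∀ k, J ≤ k → N.partialSum (N.odometer x).1 k = N.partialSum x.1 k + 1 := by
  have hex : ∃ M, N.NoCarryFrom x M := ⟨M, h⟩
  have hc := Classical.choose_spec hex
  set M' := Classical.choose hex with hM'
  refine ⟨M' + 1, fun k hk => ?_⟩
  have hx : (N.odometer x).1 = N.addOneAt x M' := by
    rw [odometer, dif_pos hex]
  obtain ⟨j, rfl⟩ : ∃ j, k = j + 1 := ⟨k - 1, by omega⟩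
  rw [hx, ← N.addOneAt_eq hc (show M' ≤ j by omega)]
  conv_rhs => rw [← partialSum_expansion (hc j (by omega))]
  refine partialSum_congr fun i hi => ?_
  rw [addOneAt, if_pos (by omega)]

theorem odometer_of_not {x : N.K} (h : ¬ ∃ M, N.NoCarryFrom x M) :
    (N.odometer x).1 = fun _ => 0 := by
  rw [odometer, dif_neg h]

/-- The set of all admissible sequences that start with `z 0, ..., z (s - 1)`. -/
def prefixSet (N : NumerationSystem) (z : ℕ → ℕ) (s : ℕ) : Set N.K := {x | ∀ i < s, x.1 i = z i}

/-- The set of all admissible sequences that start with `z 0, ..., z (s - 1)` followed by a digit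
smaller than `a`. -/
def freeSet (N : NumerationSystem) (a : ℕ) (z : ℕ → ℕ) (s : ℕ) : Set N.K :=
  {x | (∀ i < s, x.1 i = z i) ∧ x.1 s < a}

theorem freeSet_congr {a : ℕ} {z z' : ℕ → ℕ} {s : ℕ} (h : ∀ i < s, z i = z' i) :
    N.freeSet a z s = N.freeSet a z' s := by
  ext x
  refine and_congr_left' (forall₂_congr fun i hi => ?_)
  rw [h i hi]

/-- Exchanging `z` and `z'` before a digit below `a` keeps admissibility and changes all later
partial sums by exactly one; eventual partial sums determine an admissible sequence. -/
theorem ConstRec.preimage_freeSet {d a : ℕ} (H : N.ConstRec d a) {z z' : ℕ → ℕ} (hz : z ∈ N.K)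
    (hz' : z' ∈ N.K) {s : ℕ} (h : N.partialSum z s = N.partialSum z' s + 1) :
    N.odometer ⁻¹' N.freeSet a z s = N.freeSet a z' s := by
  have key : ∀ x : ℕ → ℕ, ∀ k, s ≤ k →
      N.partialSum (fun i => if i < s then z i else x i) k =
        N.partialSum (fun i => if i < s then z' i else x i) k + 1 := by
    intro x k hk
    obtain ⟨i, rfl⟩ := Nat.exists_eq_add_of_le hk
    have e1 : ∀ w : ℕ → ℕ, N.partialSum (fun i => if i < s then w i else x i) s =
        N.partialSum w s := fun w => partialSum_congr fun i hi => if_pos hi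
    rw [partialSum_add, partialSum_add, e1, e1, h]
    have e2 : ∀ w : ℕ → ℕ, ∑ l ∈ Finset.range i,
        (fun i => if i < s then w i else x i) (s + l) * N.G (s + l) =
          ∑ l ∈ Finset.range i, x (s + l) * N.G (s + l) := fun w =>
      Finset.sum_congr rfl fun l _ => by simp
    rw [e2, e2]
    omega
  have fill : ∀ {w x : ℕ → ℕ}, (∀ i < s, x i = w i) →
      (fun i => if i < s then w i else x i) = x := by
    intro w x hw
    funext i
    split_ifs with hi
    exacts [(hw i hi).symm, rfl]
  ext x
  constructor
  · rintro ⟨h1, h2⟩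
    -- Otherwise the image is `0^∞`, whose prefix has value zero, while `h` makes the value of `z`
    -- positive.
    have hno : ∃ M, N.NoCarryFrom x M := by
      by_contra hno
      rw [odometer_of_not hno] at h1
      rw [← partialSum_congr h1] at h
      simp [partialSum] at h
    obtain ⟨M, hM⟩ := hno
    obtain ⟨J, hJ⟩ := odometer_spec hM
    have hy := H.splice_mem hz' (N.odometer x).2 h2
    have hk := key (N.odometer x).1
    rw [fill h1] at hk
    have : (fun i => if i < s then z' i else (N.odometer x).1 i) = x.1 := by
      refine eq_of_eventually_partialSum_eq hy x.2 (J := max s J) fun k hk' => ?_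
      have := hk k (le_trans (le_max_left _ _) hk')
      have := hJ k (le_trans (le_max_right _ _) hk')
      omega
    refine ⟨fun i hi => ?_, ?_⟩
    · rw [← this]; exact if_pos hi
    · rw [← this]; simpa using h2
  · rintro ⟨h1, h2⟩
    have hy := H.splice_mem hz x.2 h2
    have hk := key x.1
    rw [fill h1] at hk
    -- The partial sums of `x` plus one are those of the spliced sequence, which is admissible.
    have hM : N.NoCarryFrom x s := by
      intro j hj
      rw [← hk (j + 1) (by omega)]
      exact hy (j + 1)
    obtain ⟨J, hJ⟩ := odometer_spec hM
    have : (fun i => if i < s then z i else x.1 i) = (N.odometer x).1 := by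
      refine eq_of_eventually_partialSum_eq hy (N.odometer x).2 (J := max s J) fun k hk' => ?_
      have := hk k (le_trans (le_max_left _ _) hk')
      have := hJ k (le_trans (le_max_right _ _) hk')
      omega
    refine ⟨fun i hi => ?_, ?_⟩
    · rw [← this]; exact if_pos hi
    · rw [← this]; simpa using h2

/-! ### Partitions into free sets -/

theorem measurable_digit (i : ℕ) : Measurable fun x : N.K => x.1 i :=
  (measurable_pi_apply i).comp measurable_subtype_coe

theorem measurableSet_prefixSet (z : ℕ → ℕ) (s : ℕ) : MeasurableSet (N.prefixSet z s) := by
  have : N.prefixSet z s = ⋂ i, ⋂ _ : i < s, {x | x.1 i = z i} := by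
    ext x; simp [prefixSet]
  rw [this]
  exact MeasurableSet.iInter fun i => MeasurableSet.iInter fun _ =>
    measurableSet_eq_fun (measurable_digit i) measurable_const

theorem measurableSet_freeSet (a : ℕ) (z : ℕ → ℕ) (s : ℕ) : MeasurableSet (N.freeSet a z s) :=
  (measurableSet_prefixSet z s).inter (measurableSet_lt (measurable_digit s) measurable_const)

/-- The prefix of length `k` of `z`, followed by digits `a`. -/
def padWith (a : ℕ) (z : ℕ → ℕ) (k : ℕ) : ℕ → ℕ := fun i => if i < k then z i else a

theorem freeSet_disjoint {a : ℕ} {z : ℕ → ℕ} {k m m' : ℕ} (h : m < m') :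
    Disjoint (N.freeSet a (padWith a z k) (k + m)) (N.freeSet a (padWith a z k) (k + m')) := by
  rw [Set.disjoint_left]
  rintro x ⟨_, h2⟩ ⟨h1, _⟩
  rw [h1 (k + m) (by omega), padWith, if_neg (by omega)] at h2
  exact lt_irrefl _ h2

theorem measure_freeSet_eq_sum_prefixSet (a : ℕ) (ν : Measure N.K) (z : ℕ → ℕ) (s : ℕ) :
    ν (N.freeSet a z s) =
      ∑ b ∈ Finset.range a, ν (N.prefixSet (Function.update z s b) (s + 1)) := by
  rw [← measure_biUnion_finset _ fun b _ => measurableSet_prefixSet _ _]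
  · congr 1
    ext x
    simp only [Set.mem_iUnion, Finset.mem_range, exists_prop]
    constructor
    · rintro ⟨h1, h2⟩
      refine ⟨_, h2, fun i hi => ?_⟩
      rcases Nat.lt_succ_iff_lt_or_eq.1 hi with h | rfl
      · rw [Function.update_of_ne h.ne, h1 i h]
      · rw [Function.update_self]
    · rintro ⟨b, hb, h⟩
      refine ⟨fun i hi => ?_, ?_⟩
      · rw [h i (by omega), Function.update_of_ne hi.ne]
      · rwa [h s (by omega), Function.update_self]
  · intro b _ b' _ hbb
    refine Set.disjoint_left.2 fun x h h' => hbb ?_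
    have e := h s (by omega)
    rw [h' s (by omega), Function.update_self, Function.update_self] at e
    exact e.symm

theorem exists_pred {z : ℕ → ℕ} (hz : z ∈ N.K) {s : ℕ} (hs : ∃ i < s, z i ≠ 0) :
    ∃ z' ∈ N.K, N.partialSum z s = N.partialSum z' s + 1 := by
  obtain ⟨i, hi, h0⟩ := hs
  have h1 : 0 < N.partialSum z s := by
    refine Finset.sum_pos' (fun _ _ => Nat.zero_le _) ⟨i, Finset.mem_range.2 hi, ?_⟩
    exact Nat.mul_pos (Nat.pos_of_ne_zero h0) (N.G_pos i)
  refine ⟨_, N.expansion_mem (N.partialSum z s - 1), ?_⟩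
  rw [partialSum_expansion (by have := hz s; omega)]
  omega

namespace ConstRec

variable {d a : ℕ} (H : N.ConstRec d a)
include H

/-- Here `m` is the length of the run of digits `a` after the prefix; admissibility forces `m < d`.
-/
theorem prefixSet_eq_iUnion (z : ℕ → ℕ) (k : ℕ) :
    N.prefixSet z k = ⋃ m ∈ Finset.range d, N.freeSet a (padWith a z k) (k + m) := by
  ext x
  simp only [Set.mem_iUnion, Finset.mem_range, exists_prop]
  constructor
  · intro h
    have hx := H.mem_K_iff.1 x.2
    have hex : ∃ m, x.1 (k + m) < a := by
      obtain ⟨m, _, hm⟩ := hx.2 k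
      exact ⟨m, hm⟩
    refine ⟨Nat.find hex, ?_, fun i hi => ?_, Nat.find_spec hex⟩
    · obtain ⟨m, hm, hm'⟩ := hx.2 k
      exact lt_of_le_of_lt (Nat.find_min' hex hm') hm
    · rw [padWith]
      split_ifs with h'
      · exact h i h'
      · have := Nat.find_min hex (m := i - k) (by omega)
        rw [show k + (i - k) = i by omega] at this
        exact le_antisymm (hx.1 i) (not_lt.1 this)
  · rintro ⟨m, _, h, _⟩ i hi
    rw [h i (by omega), padWith, if_pos hi]

theorem measure_prefixSet (ν : Measure N.K) (z : ℕ → ℕ) (k : ℕ) :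
    ν (N.prefixSet z k) = ∑ m ∈ Finset.range d, ν (N.freeSet a (padWith a z k) (k + m)) := by
  rw [H.prefixSet_eq_iUnion, measure_biUnion_finset _ fun b _ => measurableSet_freeSet _ _ _]
  intro m _ m' _ hm
  rcases lt_or_gt_of_ne hm with h | h
  exacts [freeSet_disjoint h, (freeSet_disjoint h).symm]

theorem measure_univ_eq_sum (ν : Measure N.K) (z : ℕ → ℕ) :
    ν Set.univ = ∑ m ∈ Finset.range d, ν (N.freeSet a (padWith a z 0) m) := by
  have : (Set.univ : Set N.K) = N.prefixSet z 0 := by ext; simp [prefixSet]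
  rw [this, H.measure_prefixSet]
  simp only [Nat.zero_add]

theorem measure_freeSet (ν : Measure N.K) (z : ℕ → ℕ) (s : ℕ) :
    ν (N.freeSet a z s) = ∑ b ∈ Finset.range a, ∑ m ∈ Finset.range d,
      ν (N.freeSet a (padWith a (Function.update z s b) (s + 1)) (s + 1 + m)) := by
  rw [measure_freeSet_eq_sum_prefixSet]
  exact Finset.sum_congr rfl fun b _ => H.measure_prefixSet ν _ _

theorem run_mem {m b : ℕ} (hm : m < d) (hb : b < a) (p : ℕ) :
    (fun i => if p ≤ i ∧ i < p + m then a else if i + 1 = p then b else 0) ∈ N.K := by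
  have ha := H.one_le_a
  have hd := H.one_le_d
  rw [H.mem_K_iff]
  refine ⟨fun j => by split_ifs <;> omega, fun j => ?_⟩
  by_cases h : p ≤ j
  · refine ⟨m, hm, ?_⟩
    rw [if_neg (by omega)]
    split_ifs <;> omega
  · refine ⟨0, hd, ?_⟩
    rw [if_neg (by omega)]
    split_ifs <;> omega

theorem exists_mem_padWith_zero {m : ℕ} (hm : m < d) (z : ℕ → ℕ) :
    ∃ y ∈ N.K, ∀ i < m, y i = padWith a z 0 i := by
  refine ⟨_, H.run_mem hm H.one_le_a 0, fun i hi => ?_⟩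
  simp [padWith, hi]

/-- The padded sequence itself ends in digits `a` and is not admissible; this supplies an admissible
representative of its prefix. -/
theorem exists_mem_padWith {z : ℕ → ℕ} (hz : z ∈ N.K) {m b : ℕ} (hm : m < d) (hb : b < a)
    (s : ℕ) :
    ∃ y ∈ N.K, ∀ i < s + 1 + m, y i = padWith a (Function.update z s b) (s + 1) i := by
  refine ⟨_, H.splice_mem hz (H.run_mem hm hb (s + 1)) (s := s) (by simp [hb]), fun i hi => ?_⟩
  simp only [padWith]
  rcases Nat.lt_trichotomy i s with h | rfl | h
  · rw [if_pos h, if_pos (by omega), Function.update_of_ne h.ne]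
  · simp
  · rw [if_neg (by omega), if_pos (by omega), if_neg (by omega)]

end ConstRec

/-! ### Free sets generate the σ-algebra; invariance -/

/-- The sets `freeSet a z s` with `z` admissible and with a nonzero digit among
`z 0, ..., z (s - 1)`, together with the empty set. -/
def freeSets (N : NumerationSystem) (a : ℕ) : Set (Set N.K) :=
  {E | E = ∅ ∨ ∃ z ∈ N.K, ∃ s, (∃ i < s, z i ≠ 0) ∧ E = N.freeSet a z s}

/-- Two free sets that meet are nested: a common point makes the longer prefix extend the shorter
one by a digit below `a`. -/
theorem isPiSystem_freeSets (a : ℕ) : IsPiSystem (N.freeSets a) := by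
  rintro E (rfl | ⟨z, hz, s, h0, rfl⟩) E' (rfl | ⟨z', hz', s', h0', rfl⟩) ⟨x, hx, hx'⟩
  · exact hx.elim
  · exact hx.elim
  · exact hx'.elim
  rcases Nat.lt_trichotomy s s' with h | rfl | h
  · refine Or.inr ⟨z', hz', s', h0', Set.inter_eq_right.2 ?_⟩
    rintro y ⟨h1, h2⟩
    refine ⟨fun i hi => ?_, ?_⟩
    · rw [h1 i (by omega), ← hx'.1 i (by omega), hx.1 i hi]
    · rw [h1 s h, ← hx'.1 s h]; exact hx.2
  · refine Or.inr ⟨z, hz, s, h0, ?_⟩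
    rw [Set.inter_eq_left]
    rw [freeSet_congr (z := z) (z' := z') fun i hi => by rw [← hx.1 i hi, hx'.1 i hi]]
  · refine Or.inr ⟨z, hz, s, h0, Set.inter_eq_left.2 ?_⟩
    rintro y ⟨h1, h2⟩
    refine ⟨fun i hi => ?_, ?_⟩
    · rw [h1 i (by omega), ← hx.1 i (by omega), hx'.1 i hi]
    · rw [h1 s' h, ← hx.1 s' h]; exact hx'.2

namespace ConstRec

variable {d a : ℕ} (H : N.ConstRec d a)
include H

theorem measurableSpace_eq :
    (inferInstance : MeasurableSpace N.K) = MeasurableSpace.generateFrom (N.freeSets a) := by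
  apply le_antisymm
  · have hne : ∀ i b, b ≠ 0 →
        MeasurableSet[MeasurableSpace.generateFrom (N.freeSets a)] {x : N.K | x.1 i = b} := by
      intro i b hb
      have : {x : N.K | x.1 i = b} = ⋃ n, ⋃ s, ⋃ _ : i < s ∧ N.expansion n i = b,
          N.freeSet a (N.expansion n) s := by
        ext x
        simp only [Set.mem_ofPred_eq, Set.mem_iUnion, exists_prop]
        constructor
        · intro hx
          obtain ⟨m, _, hm⟩ := (H.mem_K_iff.1 x.2).2 (i + 1)
          have he := eq_of_partialSum_eq x.2 (N.expansion_mem (N.partialSum x.1 (i + 1 + m)))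
            (partialSum_expansion (x.2 (i + 1 + m))).symm
          exact ⟨_, _, ⟨by omega, by rw [← hx, ← he i (by omega)]⟩, he, hm⟩
        · rintro ⟨n, s, ⟨h1, h2⟩, h3, _⟩
          rw [h3 i h1, h2]
      rw [this]
      refine MeasurableSet.iUnion fun n => MeasurableSet.iUnion fun s =>
        MeasurableSet.iUnion fun h => MeasurableSpace.measurableSet_generateFrom ?_
      exact Or.inr ⟨_, N.expansion_mem n, s, ⟨i, h.1, by rw [h.2]; exact hb⟩, rfl⟩
    have hmeas : ∀ i, Measurable[MeasurableSpace.generateFrom (N.freeSets a)]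
        fun x : N.K => x.1 i := by
      intro i
      refine @measurable_to_countable' ℕ _ _ _ (MeasurableSpace.generateFrom (N.freeSets a)) _
        fun b => ?_
      rcases Nat.eq_zero_or_pos b with rfl | hb
      · have : (fun x : N.K => x.1 i) ⁻¹' {0} = (⋃ b, {x : N.K | x.1 i = b + 1})ᶜ := by
          ext x
          simp only [Set.mem_preimage, Set.mem_singleton_iff, Set.mem_compl_iff, Set.mem_iUnion,
            Set.mem_ofPred_eq, not_exists]
          exact ⟨fun h b => by omega, fun h => by
            by_contra h0
            exact h (x.1 i - 1) (by omega)⟩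
        rw [this]
        exact MeasurableSet.compl (MeasurableSet.iUnion fun b => hne i _ (Nat.succ_ne_zero b))
      · exact hne i b hb.ne'
    have h2 : Measurable[MeasurableSpace.generateFrom (N.freeSets a)] fun x : N.K => x.1 :=
      @measurable_pi_lambda _ _ _ (MeasurableSpace.generateFrom (N.freeSets a)) _ _ hmeas
    exact h2.comap_le
  · refine MeasurableSpace.generateFrom_le ?_
    rintro E (rfl | ⟨z, _, s, _, rfl⟩)
    exacts [MeasurableSet.empty, measurableSet_freeSet _ _ _]

theorem measurable_odometer : Measurable N.odometer := by
  have : @Measurable _ _ _ (MeasurableSpace.generateFrom (N.freeSets a)) N.odometer := by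
    refine measurable_generateFrom ?_
    rintro E (rfl | ⟨z, hz, s, hs, rfl⟩)
    · exact MeasurableSet.empty
    · obtain ⟨z', hz', h⟩ := exists_pred hz hs
      rw [H.preimage_freeSet hz hz' h]
      exact measurableSet_freeSet _ _ _
  rwa [← H.measurableSpace_eq] at this

theorem measure_ext {μ ν : Measure N.K} [IsProbabilityMeasure μ] [IsProbabilityMeasure ν]
    (h : ∀ z ∈ N.K, ∀ s, (∃ i < s, z i ≠ 0) → μ (N.freeSet a z s) = ν (N.freeSet a z s)) :
    μ = ν := by
  refine ext_of_generate_finite (N.freeSets a) H.measurableSpace_eq (isPiSystem_freeSets a) ?_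
    (by rw [measure_univ, measure_univ])
  rintro E (rfl | ⟨z, hz, s, hs, rfl⟩)
  exacts [by simp, h z hz s hs]

theorem measurePreserving_odometer {μ : Measure N.K} [IsProbabilityMeasure μ] (f : ℕ → ENNReal)
    (h : ∀ z ∈ N.K, ∀ s, μ (N.freeSet a z s) = f s) : MeasurePreserving N.odometer μ μ := by
  refine ⟨H.measurable_odometer, ?_⟩
  have := Measure.isProbabilityMeasure_map (μ := μ) H.measurable_odometer.aemeasurable
  refine H.measure_ext fun z hz s hs => ?_
  obtain ⟨z', hz', hzz⟩ := exists_pred hz hs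
  rw [Measure.map_apply H.measurable_odometer (measurableSet_freeSet _ _ _),
    H.preimage_freeSet hz hz' hzz, h z hz, h z' hz']

/-- Descend by pulling back along the odometer until the prefix has value zero. -/
theorem measure_freeSet_eq_of_invariant {ν : Measure N.K} (hν : MeasurePreserving N.odometer ν ν)
    {z : ℕ → ℕ} (hz : z ∈ N.K) (s : ℕ) :
    ν (N.freeSet a z s) = ν (N.freeSet a (fun _ => 0) s) := by
  induction hn : N.partialSum z s generalizing z with
  | zero =>
    refine congrArg ν (freeSet_congr fun i hi => ?_)
    rw [partialSum, Finset.sum_eq_zero_iff] at hn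
    have := hn i (Finset.mem_range.2 hi)
    exact (Nat.mul_eq_zero.1 this).resolve_right (N.G_pos i).ne'
  | succ n ih =>
    have hs : ∃ i < s, z i ≠ 0 := by
      by_contra! h0
      rw [partialSum_congr (y := fun _ => 0) h0] at hn
      simp [partialSum] at hn
    obtain ⟨z', hz', h⟩ := exists_pred hz hs
    rw [← ih hz' (by omega), ← H.preimage_freeSet hz hz' h,
      hν.measure_preimage (measurableSet_freeSet _ _ _).nullMeasurableSet]

end ConstRec

end NumerationSystem

/-! ### Sequences averaging their next terms -/

/-- A sequence that is bounded above and each of whose terms is a convex combination, with fixed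
positive weights, of the next `d` terms is constant. -/
theorem eq_iSup_of_forall_eq_sum_weights {d : ℕ} {c : ℕ → ℝ} (hd : 1 ≤ d)
    (hc : ∀ i < d, 0 < c i) (hc1 : ∑ i ∈ Finset.range d, c i = 1) {u : ℕ → ℝ}
    (hB : BddAbove (Set.range u))
    (hu : ∀ n, u n = ∑ i ∈ Finset.range d, c i * u (n + 1 + i)) (l : ℕ) :
    u l = ⨆ n, u n := by
  set S := ⨆ n, u n with hS
  have hle : ∀ n, u n ≤ S := le_ciSup hB
  obtain ⟨κ, hκ0, hκ⟩ : ∃ κ, 0 < κ ∧ ∀ i < d, κ ≤ c i := by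
    obtain ⟨i, hi, h⟩ := Finset.exists_min_image (Finset.range d) c ⟨0, Finset.mem_range.2 hd⟩
    exact ⟨c i, hc i (Finset.mem_range.1 hi), fun j hj => h j (Finset.mem_range.2 hj)⟩
  have deficit : ∀ M n, M - u n = ∑ j ∈ Finset.range d, c j * (M - u (n + 1 + j)) := by
    intro M n
    simp only [mul_sub, Finset.sum_sub_distrib, ← Finset.sum_mul, hc1, one_mul, ← hu n]
  have above : ∀ n i, i < d → κ * (S - u (n + 1 + i)) ≤ S - u n := by
    intro n i hi
    refine (mul_le_mul_of_nonneg_right (hκ i hi) (sub_nonneg.2 (hle _))).trans ?_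
    rw [deficit S n]
    exact Finset.single_le_sum (f := fun j => c j * (S - u (n + 1 + j)))
      (fun j hj => mul_nonneg (hc j (Finset.mem_range.1 hj)).le (sub_nonneg.2 (hle _)))
      (Finset.mem_range.2 hi)
  -- If all terms after `n` were at most `S - ε`, then so would be `u n`, their average.
  have far : ∀ ε > 0, ∀ k, ∃ n, k ≤ n ∧ S - ε < u n := by
    intro ε hε k
    induction k with
    | zero =>
      obtain ⟨n, hn⟩ := exists_lt_of_lt_ciSup (show S - ε < ⨆ n, u n by rw [← hS]; linarith)
      exact ⟨n, Nat.zero_le _, hn⟩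
    | succ k ih =>
      obtain ⟨n, hn, h⟩ := ih
      by_contra! hcon
      have h1 := deficit (S - ε) n
      have h2 : 0 ≤ ∑ j ∈ Finset.range d, c j * (S - ε - u (n + 1 + j)) :=
        Finset.sum_nonneg fun j hj => mul_nonneg (hc j (Finset.mem_range.1 hj)).le
          (sub_nonneg.2 (hcon _ (by omega)))
      linarith
  have back : ∀ A n, (∀ j < d, A ≤ u (n + j)) → ∀ l ≤ n, A ≤ u l := by
    intro A n
    induction n with
    | zero =>
      intro h l hl
      obtain rfl : l = 0 := by omega
      exact h 0 hd
    | succ n ih =>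
      intro h l hl
      rcases Nat.lt_succ_iff_lt_or_eq.1 (Nat.lt_succ_of_le hl) with hl' | rfl
      · refine ih (fun j hj => ?_) l (by omega)
        rcases j with _ | j
        · have h1 := deficit A n
          have h2 : ∑ j ∈ Finset.range d, c j * (A - u (n + 1 + j)) ≤ 0 :=
            Finset.sum_nonpos fun j hj => mul_nonpos_of_nonneg_of_nonpos
              (hc j (Finset.mem_range.1 hj)).le (sub_nonpos.2 (h j (Finset.mem_range.1 hj)))
          rw [Nat.add_zero]
          linarith
        · rw [show n + (j + 1) = n + 1 + j by omega]
          exact h j (by omega)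
      · exact h 0 hd
  refine le_antisymm (hle l) (le_of_forall_pos_le_add fun ε hε => ?_)
  -- A term within `κ * ε` of the supremum forces the next `d` terms within `ε`, as each weight is
  -- at least `κ`; `back` carries this bound down to `l`.
  obtain ⟨n, hn, h⟩ := far (κ * ε) (mul_pos hκ0 hε) l
  have h1 : S - ε ≤ u l := by
    refine back (S - ε) (n + 1) (fun j hj => ?_) l (by omega)
    have h2 := above n j hj
    have h3 : κ * (S - u (n + 1 + j)) < κ * ε := by linarith
    have := lt_of_mul_lt_mul_left h3 hκ0.le
    linarith
  linarith

/-- A nonnegative sequence each of whose terms is a convex combination, with fixed positive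
weights, of the next `d` terms is bounded: the combination of `d` consecutive terms whose
coefficients are the tail sums of the weights does not depend on the position. -/
theorem bddAbove_of_forall_eq_sum_weights {d : ℕ} {c : ℕ → ℝ} (hd : 1 ≤ d)
    (hc : ∀ i < d, 0 < c i) (hc1 : ∑ i ∈ Finset.range d, c i = 1) {u : ℕ → ℝ} (h0 : ∀ n, 0 ≤ u n)
    (hu : ∀ n, u n = ∑ i ∈ Finset.range d, c i * u (n + 1 + i)) :
    BddAbove (Set.range u) := by
  set t : ℕ → ℝ := fun i => ∑ j ∈ Finset.Ico i d, c j with ht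
  have ht0 : t 0 = 1 := by rw [ht, ← hc1, Finset.range_eq_Ico]
  have htd : t d = 0 := by simp [ht]
  have hts : ∀ i < d, t i = c i + t (i + 1) := fun i hi => by
    simp only [ht]
    exact Finset.sum_eq_sum_Ico_succ_bot hi _
  have htn : ∀ i, 0 ≤ t i := fun i =>
    Finset.sum_nonneg fun j hj => (hc j (Finset.mem_Ico.1 hj).2).le
  set F : ℕ → ℝ := fun n => ∑ i ∈ Finset.range d, t i * u (n + i) with hF
  have hstep : ∀ n, F (n + 1) = F n := by
    intro n
    -- Expanding `u n` merges `c i` with `t (i + 1)` into `t i`; the shifted sum then telescopes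
    -- because `t 0 = 1` and `t d = 0`.
    have e1 : F (n + 1) = u n + ∑ i ∈ Finset.range d, t (i + 1) * u (n + (i + 1)) := by
      rw [hu n, ← Finset.sum_add_distrib]
      refine Finset.sum_congr rfl fun i hi => ?_
      rw [hts i (Finset.mem_range.1 hi), show n + 1 + i = n + (i + 1) by omega]
      ring
    have e2 := Finset.sum_range_succ (fun i => t i * u (n + i)) d
    rw [Finset.sum_range_succ', htd, ht0] at e2
    simp only [hF] at e1 ⊢
    rw [e1]
    simp only [one_mul, zero_mul, add_zero] at e2
    linarith
  have hconst : ∀ n, F n = F 0 := by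
    intro n
    induction n with
    | zero => rfl
    | succ n ih => rw [hstep, ih]
  refine ⟨F 0, ?_⟩
  rintro _ ⟨n, rfl⟩
  rw [← hconst n]
  have := Finset.single_le_sum (f := fun i => t i * u (n + i))
    (fun i _ => mul_nonneg (htn i) (h0 _)) (Finset.mem_range.2 hd)
  simpa [ht0] using this

/-! ### The characteristic root and the forced masses -/

/-- The digit `a` repeated `d` times represents `1` in base `β`; this is the equation of the
characteristic root together with its consequences `1 < β < a + 1`. -/
structure IsConstRoot (d a : ℕ) (β : ℝ) : Prop where
  one_lt : 1 < β
  lt_succ : β < a + 1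
  sum_eq : ∑ i ∈ Finset.range d, (a : ℝ) / β ^ (i + 1) = 1

namespace NumerationSystem

variable {N : NumerationSystem}

theorem ConstRec.isConstRoot {d a : ℕ} (H : N.ConstRec d a) {c : ℕ → ℕ}
    (hc : ∀ j, j < d → c j = a) {β : ℝ} (hβ : IsCharacteristicRoot d c β) :
    IsConstRoot d a β := by
  obtain ⟨h0, h⟩ := hβ
  have hsum : β ^ d = ∑ j ∈ Finset.range d, (a : ℝ) * β ^ (d - 1 - j) := by
    rw [h]
    exact Finset.sum_congr rfl fun j hj => by rw [hc j (Finset.mem_range.1 hj)]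
  have ha : (1 : ℝ) ≤ a := by exact_mod_cast H.one_le_a
  obtain ⟨e, rfl⟩ : ∃ e, d = e + 1 := ⟨d - 1, by have := H.one_le_d; omega⟩
  have h1 : ∑ i ∈ Finset.range (e + 1), (a : ℝ) / β ^ (i + 1) = 1 := by
    have : ∀ i ∈ Finset.range (e + 1), (a : ℝ) / β ^ (i + 1) =
        a * β ^ (e + 1 - 1 - i) / β ^ (e + 1) := by
      intro i hi
      have hi' := Finset.mem_range.1 hi
      rw [div_eq_div_iff (by positivity) (by positivity), mul_assoc, ← pow_add]
      congr 2
      omega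
    rw [Finset.sum_congr rfl this, ← Finset.sum_div, ← hsum]
    exact div_self (by positivity)
  refine ⟨?_, ?_, h1⟩
  -- For `d = 1` the root is `a`, and strict growth of `G` gives `a > 1`. For `d ≥ 2`, `β ≤ 1` would
  -- make the sum at least `2`.
  · rcases Nat.eq_zero_or_pos e with rfl | he
    · have h2 := H.step 0
      have h3 := N.strictMono' Nat.zero_lt_one
      simp only [Nat.zero_add, Finset.sum_range_one, N.zero', mul_one] at h2 h3
      rw [h2] at h3
      simp only [Nat.zero_add, pow_one, Finset.sum_range_one] at hsum
      rw [hsum]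
      simpa using (by exact_mod_cast h3 : (1 : ℝ) < a)
    · by_contra! hle
      have h2 := Finset.card_nsmul_le_sum (Finset.range (e + 1))
        (fun i => (a : ℝ) / β ^ (i + 1)) 1 fun i _ => by
          rw [le_div_iff₀ (by positivity), one_mul]
          exact (pow_le_one₀ h0.le hle).trans ha
      rw [h1, Finset.card_range, nsmul_one] at h2
      have h3 : (2 : ℝ) ≤ (e + 1 : ℕ) := by exact_mod_cast Nat.succ_le_succ he
      linarith
  -- Multiplying the equation by `β` yields `β = a + 1 - a / β ^ d`.
  · have h2 : ∑ i ∈ Finset.range (e + 1), (a : ℝ) / β ^ i = β := by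
      have := congrArg (β * ·) h1
      simp only [Finset.mul_sum, mul_one] at this
      refine Eq.trans (Finset.sum_congr rfl fun i _ => ?_) this
      rw [pow_succ]
      field_simp
    rw [Finset.sum_range_succ'] at h2
    rw [Finset.sum_range_succ] at h1
    have h3 : 0 < (a : ℝ) / β ^ (e + 1) := by positivity
    simp only [pow_zero, div_one] at h2
    linarith

end NumerationSystem

theorem IsConstRoot.sum_const_le {d a : ℕ} {β : ℝ} (h : IsConstRoot d a β) {n : ℕ} (hn : n ≤ d) :
    ∑ i ∈ Finset.range n, (a : ℝ) / β ^ (i + 1) ≤ 1 := by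
  have := h.one_lt
  rw [← h.sum_eq]
  refine Finset.sum_le_sum_of_subset_of_nonneg (fun i hi => ?_) fun _ _ _ => by positivity
  rw [Finset.mem_range] at *
  omega

namespace NumerationSystem
variable {N : NumerationSystem}

theorem ConstRec.measureReal_freeSet_of_invariant {d a : ℕ} (H : N.ConstRec d a) {β : ℝ}
    (hβ : IsConstRoot d a β) {ν : Measure N.K} [IsProbabilityMeasure ν]
    (hν : MeasurePreserving N.odometer ν ν) {z : ℕ → ℕ} (hz : z ∈ N.K) (s : ℕ) :
    ν.real (N.freeSet a z s) = a / β ^ (s + 1) := by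
  have hβ1 := hβ.one_lt
  have ha : (1 : ℝ) ≤ a := by exact_mod_cast H.one_le_a
  set q : ℕ → ℝ := fun s => ν.real (N.freeSet a (fun _ => 0) s) with hq
  have hall : ∀ z ∈ N.K, ∀ s, ν.real (N.freeSet a z s) = q s := fun z hz s =>
    congrArg ENNReal.toReal (H.measure_freeSet_eq_of_invariant hν hz s)
  have hrec : ∀ s, q s = ∑ m ∈ Finset.range d, a * q (s + 1 + m) := by
    intro s
    have e := congrArg ENNReal.toReal (H.measure_freeSet ν (fun _ => 0) s)
    rw [ENNReal.toReal_sum (fun b _ => ENNReal.sum_ne_top.2 fun m _ => measure_ne_top _ _)] at e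
    have e2 : ∀ b ∈ Finset.range a, (∑ m ∈ Finset.range d, ν (N.freeSet a
        (padWith a (Function.update (fun _ => 0) s b) (s + 1)) (s + 1 + m))).toReal =
          ∑ m ∈ Finset.range d, q (s + 1 + m) := by
      intro b hb
      rw [ENNReal.toReal_sum fun m _ => measure_ne_top _ _]
      refine Finset.sum_congr rfl fun m hm => ?_
      obtain ⟨y, hy, hyi⟩ := H.exists_mem_padWith N.zero_mem (Finset.mem_range.1 hm)
        (Finset.mem_range.1 hb) s
      rw [← freeSet_congr hyi]
      exact hall y hy _
    rw [Finset.sum_congr rfl e2, Finset.sum_const, Finset.card_range, nsmul_eq_mul,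
      Finset.mul_sum] at e
    exact e
  have huniv : ∑ m ∈ Finset.range d, q m = 1 := by
    have e := congrArg ENNReal.toReal (H.measure_univ_eq_sum ν (fun _ => 0))
    rw [measure_univ, ENNReal.toReal_one, ENNReal.toReal_sum fun m _ => measure_ne_top _ _] at e
    rw [e]
    refine Finset.sum_congr rfl fun m hm => ?_
    obtain ⟨y, hy, hyi⟩ := H.exists_mem_padWith_zero (Finset.mem_range.1 hm) fun _ => 0
    rw [← freeSet_congr hyi]
    exact (hall y hy _).symm
  have hu : ∀ n, q n * β ^ n = ∑ i ∈ Finset.range d,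
      (a : ℝ) / β ^ (i + 1) * (q (n + 1 + i) * β ^ (n + 1 + i)) := by
    intro n
    rw [hrec n, Finset.sum_mul]
    refine Finset.sum_congr rfl fun i _ => ?_
    rw [show n + 1 + i = n + (i + 1) by omega, pow_add β n (i + 1)]
    field_simp
  have hpos : ∀ i < d, 0 < (a : ℝ) / β ^ (i + 1) := fun i _ => by positivity
  have hb := bddAbove_of_forall_eq_sum_weights H.one_le_d hpos hβ.sum_eq
    (u := fun n => q n * β ^ n) (fun n => by positivity) hu
  have hconst := eq_iSup_of_forall_eq_sum_weights H.one_le_d hpos hβ.sum_eq hb hu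
  set S := ⨆ n, q n * β ^ n
  have hqS : ∀ n, q n = S / β ^ n := fun n => by
    rw [← hconst n, mul_div_cancel_right₀ _ (by positivity)]
  have hS : S * β / a = 1 := by
    rw [← huniv, ← mul_one (S * β / a), ← hβ.sum_eq, Finset.mul_sum]
    refine Finset.sum_congr rfl fun m _ => ?_
    rw [hqS, pow_succ]
    field_simp
  have hS' : S = a / β := by
    rw [div_eq_one_iff_eq (by positivity)] at hS
    rw [← hS, mul_div_cancel_right₀ _ (by positivity)]
  rw [hall z hz, hqS, hS', pow_succ, div_div, mul_comm β]

end NumerationSystem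

/-! ### Greedy expansions and the Lebesgue pushforward -/

/-- The `j`-th digit of the greedy expansion of `t ∈ [0, 1)` in base `β`. -/
noncomputable def greedyDigit (β t : ℝ) (j : ℕ) : ℕ :=
  ⌊β * (fun s => Int.fract (β * s))^[j] t⌋₊

theorem measurable_greedyDigit (β : ℝ) (j : ℕ) : Measurable fun t => greedyDigit β t j := by
  have h : Measurable fun s : ℝ => Int.fract (β * s) :=
    measurable_fract.comp (measurable_const_mul β)
  exact Nat.measurable_floor.comp ((measurable_const_mul β).comp (h.iterate j))

theorem iterate_fract_mem {β t : ℝ} (ht : t ∈ Set.Ico (0 : ℝ) 1) (j : ℕ) :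
    (fun s => Int.fract (β * s))^[j] t ∈ Set.Ico (0 : ℝ) 1 := by
  rcases j with _ | j
  · exact ht
  · rw [Function.iterate_succ_apply']
    exact ⟨Int.fract_nonneg _, Int.fract_lt_one _⟩

theorem iterate_fract_eq_sum {β t : ℝ} (hβ : 0 < β) (ht : t ∈ Set.Ico (0 : ℝ) 1) (j n : ℕ) :
    (fun s => Int.fract (β * s))^[j] t =
      ∑ i ∈ Finset.range n, (greedyDigit β t (j + i) : ℝ) / β ^ (i + 1) +
        (fun s => Int.fract (β * s))^[j + n] t / β ^ n := by
  induction n with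
  | zero => simp
  | succ n ih =>
    rw [Finset.sum_range_succ, add_assoc]
    refine ih.trans (congrArg _ ?_)
    have h0 := (iterate_fract_mem (β := β) ht (j + n)).1
    rw [← Nat.add_assoc, Function.iterate_succ_apply', greedyDigit]
    set v := (fun s => Int.fract (β * s))^[j + n] t
    have h1 : (⌊β * v⌋₊ : ℝ) + Int.fract (β * v) = β * v := by
      rw [natCast_floor_eq_intCast_floor (by positivity)]
      exact Int.floor_add_fract _
    rw [← add_div, h1, pow_succ]
    field_simp

theorem hasSum_greedyDigit {β t : ℝ} (hβ : 1 < β) (ht : t ∈ Set.Ico (0 : ℝ) 1) :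
    HasSum (fun i => (greedyDigit β t i : ℝ) / β ^ (i + 1)) t := by
  have hβ0 : 0 < β := by linarith
  rw [hasSum_iff_tendsto_nat_of_nonneg fun i => by positivity]
  have h1 : Filter.Tendsto (fun n => t - (fun s => Int.fract (β * s))^[n] t / β ^ n)
      Filter.atTop (nhds (t - 0)) := by
    refine tendsto_const_nhds.sub ?_
    refine squeeze_zero (fun n => ?_) (fun n => ?_)
      (tendsto_pow_atTop_nhds_zero_of_lt_one (inv_nonneg.2 hβ0.le) (inv_lt_one_of_one_lt₀ hβ))
    · exact div_nonneg (iterate_fract_mem ht n).1 (by positivity)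
    · rw [inv_pow, ← one_div]
      exact div_le_div_of_nonneg_right (iterate_fract_mem ht n).2.le (by positivity)
  rw [sub_zero] at h1
  refine h1.congr fun n => ?_
  have := iterate_fract_eq_sum hβ0 ht 0 n
  simp only [Nat.zero_add, Function.iterate_zero, id] at this
  linarith

namespace NumerationSystem

variable {N : NumerationSystem} {d a : ℕ} {β : ℝ}

theorem ConstRec.greedyDigit_mem (H : N.ConstRec d a) (hβ : IsConstRoot d a β) {t : ℝ}
    (ht : t ∈ Set.Ico (0 : ℝ) 1) : greedyDigit β t ∈ N.K := by
  have hβ1 := hβ.one_lt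
  have hle : ∀ j, greedyDigit β t j ≤ a := by
    intro j
    obtain ⟨h0, h1⟩ := iterate_fract_mem (β := β) ht j
    have h2 : β * (fun s => Int.fract (β * s))^[j] t < ((a + 1 : ℕ) : ℝ) := by
      push_cast
      have := hβ.lt_succ
      nlinarith
    exact Nat.lt_succ_iff.1 ((Nat.floor_lt (by positivity)).2 h2)
  refine H.mem_K_iff.2 ⟨hle, fun j => ?_⟩
  -- A run of `d` digits `a` would already contribute `1` to an orbit point that is below `1`.
  by_contra! hcon
  have h1 := iterate_fract_eq_sum (by linarith) ht (β := β) j d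
  have h2 : ∑ i ∈ Finset.range d, (greedyDigit β t (j + i) : ℝ) / β ^ (i + 1) = 1 := by
    rw [← hβ.sum_eq]
    refine Finset.sum_congr rfl fun i hi => ?_
    rw [le_antisymm (hle (j + i)) (hcon i (Finset.mem_range.1 hi))]
  have h3 := (iterate_fract_mem (β := β) ht j).2
  have h4 : 0 ≤ (fun s => Int.fract (β * s))^[j + d] t / β ^ d :=
    div_nonneg (iterate_fract_mem ht _).1 (by positivity)
  linarith

/-- The Monna map has a measurable section on `[0, 1)`, the greedy expansion. -/
theorem ConstRec.exists_section (H : N.ConstRec d a) (hβ : IsConstRoot d a β) :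
    ∃ e : ℝ → N.K, Measurable e ∧ ∀ t ∈ Set.Ico (0 : ℝ) 1, N.monna β (e t) = t := by
  have hm : ∀ t : ℝ, greedyDigit β (Int.fract t) ∈ N.K := fun t =>
    H.greedyDigit_mem hβ ⟨Int.fract_nonneg _, Int.fract_lt_one _⟩
  refine ⟨fun t => ⟨_, hm t⟩, ?_, fun t ht => ?_⟩
  · exact Measurable.subtype_mk (measurable_pi_lambda _ fun j =>
      (measurable_greedyDigit β j).comp measurable_fract)
  · simpa only [monna, Int.fract_eq_self.2 ht] using (hasSum_greedyDigit hβ.one_lt ht).tsum_eq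

/-- If the section sends `t` into `A`, then `t` lies in the image of `A`. -/
theorem ConstRec.exists_measure_le_image (H : N.ConstRec d a) (hβ : IsConstRoot d a β) :
    ∃ μ : Measure N.K, IsProbabilityMeasure μ ∧
      ∀ A, MeasurableSet A → μ A ≤ volume (N.monna β '' A) := by
  obtain ⟨e, he, h⟩ := H.exists_section hβ
  have hp : IsProbabilityMeasure (volume.restrict (Set.Ico (0 : ℝ) 1)) := ⟨by simp⟩
  refine ⟨Measure.map e (volume.restrict (Set.Ico 0 1)),
    Measure.isProbabilityMeasure_map he.aemeasurable, fun A hA => ?_⟩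
  rw [Measure.map_apply he hA, Measure.restrict_apply (he hA)]
  exact measure_mono fun t ht => ⟨e t, ht.1, h t ht.2⟩

/-! ### Images under the Monna map -/

theorem ConstRec.sum_digits_le_one (H : N.ConstRec d a) (hβ : IsConstRoot d a β) {x : ℕ → ℕ}
    (hx : x ∈ N.K) (n j : ℕ) : ∑ i ∈ Finset.range n, (x (j + i) : ℝ) / β ^ (i + 1) ≤ 1 := by
  have hβ1 := hβ.one_lt
  rw [H.mem_K_iff] at hx
  induction n using Nat.strong_induction_on generalizing j with
  | _ n ih =>
  have hex : ∃ i, x (j + i) < a := by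
    obtain ⟨i, _, hi⟩ := hx.2 j
    exact ⟨i, hi⟩
  obtain ⟨i, hid, hi, hmin⟩ : ∃ i < d, x (j + i) < a ∧ ∀ l < i, x (j + l) = a := by
    refine ⟨Nat.find hex, ?_, Nat.find_spec hex, fun l hl =>
      le_antisymm (hx.1 _) (not_lt.1 (Nat.find_min hex hl))⟩
    obtain ⟨i, hi, hi'⟩ := hx.2 j
    exact lt_of_le_of_lt (Nat.find_min' hex hi') hi
  -- The tail after the first digit below `a` is worth at most one unit of that digit, so the sum is
  -- bounded by a run of at most `d` digits `a`.
  rcases Nat.lt_or_ge i n with hin | hin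
  · obtain ⟨k, rfl⟩ := Nat.exists_eq_add_of_le (show i + 1 ≤ n from hin)
    have h1 := ih k (by omega) (j + i + 1)
    have h2 := hβ.sum_const_le (n := i + 1) hid
    rw [Finset.sum_range_add, Finset.sum_range_succ]
    rw [Finset.sum_range_succ] at h2
    have h3 : ∑ l ∈ Finset.range i, (x (j + l) : ℝ) / β ^ (l + 1) =
        ∑ l ∈ Finset.range i, (a : ℝ) / β ^ (l + 1) :=
      Finset.sum_congr rfl fun l hl => by rw [hmin l (Finset.mem_range.1 hl)]
    have h4 : ∑ l ∈ Finset.range k, (x (j + (i + 1 + l)) : ℝ) / β ^ (i + 1 + l + 1) =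
        (∑ l ∈ Finset.range k, (x (j + i + 1 + l) : ℝ) / β ^ (l + 1)) / β ^ (i + 1) := by
      rw [Finset.sum_div]
      refine Finset.sum_congr rfl fun l _ => ?_
      rw [div_div, ← pow_add, show j + (i + 1 + l) = j + i + 1 + l by omega]
      congr 2
      omega
    rw [h3, h4]
    have h5 : (x (j + i) : ℝ) + 1 ≤ a := by exact_mod_cast hi
    have h6 : (x (j + i) : ℝ) / β ^ (i + 1) +
        (∑ l ∈ Finset.range k, (x (j + i + 1 + l) : ℝ) / β ^ (l + 1)) / β ^ (i + 1) ≤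
          (a : ℝ) / β ^ (i + 1) := by
      rw [← add_div]
      exact div_le_div_of_nonneg_right (by linarith) (by positivity)
    linarith
  · refine le_trans (le_of_eq (Finset.sum_congr rfl fun l hl => ?_))
      (hβ.sum_const_le (n := n) (by omega))
    rw [hmin l (by have := Finset.mem_range.1 hl; omega)]

theorem ConstRec.summable_monna (H : N.ConstRec d a) (hβ : IsConstRoot d a β) {x : ℕ → ℕ}
    (hx : x ∈ N.K) (j : ℕ) : Summable fun i => (x (j + i) : ℝ) / β ^ (i + 1) := by
  have hβ1 := hβ.one_lt
  exact summable_of_sum_range_le (fun i => by positivity) fun n => H.sum_digits_le_one hβ hx n j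

theorem ConstRec.monna_freeSet_subset (H : N.ConstRec d a) (hβ : IsConstRoot d a β) (z : ℕ → ℕ)
    (s : ℕ) : N.monna β '' N.freeSet a z s ⊆
      Set.Icc (∑ i ∈ Finset.range s, (z i : ℝ) / β ^ (i + 1))
        (∑ i ∈ Finset.range s, (z i : ℝ) / β ^ (i + 1) + a / β ^ (s + 1)) := by
  have hβ1 := hβ.one_lt
  rintro _ ⟨x, ⟨h1, h2⟩, rfl⟩
  have hs := H.summable_monna hβ x.2 0
  simp only [Nat.zero_add] at hs
  have e : N.monna β x = ∑ i ∈ Finset.range s, (z i : ℝ) / β ^ (i + 1) +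
      (x.1 s + ∑' i, (x.1 (s + 1 + i) : ℝ) / β ^ (i + 1)) / β ^ (s + 1) := by
    rw [monna, ← hs.sum_add_tsum_nat_add (s + 1), Finset.sum_range_succ, add_div, ← tsum_div_const,
      add_assoc]
    congr 1
    · exact Finset.sum_congr rfl fun i hi => by rw [h1 i (Finset.mem_range.1 hi)]
    · congr 1
      refine tsum_congr fun i => ?_
      rw [div_div, ← pow_add, show i + (s + 1) = s + 1 + i by omega]
      congr 2
      omega
  have t0 : 0 ≤ ∑' i, (x.1 (s + 1 + i) : ℝ) / β ^ (i + 1) := tsum_nonneg fun i => by positivity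
  have t1 : ∑' i, (x.1 (s + 1 + i) : ℝ) / β ^ (i + 1) ≤ 1 :=
    Real.tsum_le_of_sum_range_le (fun i => by positivity) fun n =>
      H.sum_digits_le_one hβ x.2 n (s + 1)
  have h3 : (x.1 s : ℝ) + 1 ≤ a := by exact_mod_cast h2
  rw [e]
  refine ⟨le_add_of_nonneg_right (by positivity), ?_⟩
  exact add_le_add_right (div_le_div_of_nonneg_right (by linarith) (by positivity)) _

theorem ConstRec.volume_monna_freeSet_le (H : N.ConstRec d a) (hβ : IsConstRoot d a β)
    (z : ℕ → ℕ) (s : ℕ) :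
    volume (N.monna β '' N.freeSet a z s) ≤ ENNReal.ofReal (a / β ^ (s + 1)) := by
  refine (measure_mono (H.monna_freeSet_subset hβ z s)).trans ?_
  rw [Real.volume_Icc, add_sub_cancel_left]

theorem isClosed_K : IsClosed N.K := by
  have : N.K = ⋂ k, {x : ℕ → ℕ | N.partialSum x k < N.G k} := by ext; simp [K]
  rw [this]
  refine isClosed_iInter fun k => ?_
  have hc : Continuous fun x : ℕ → ℕ => N.partialSum x k := by
    unfold partialSum
    fun_prop
  exact (isClosed_discrete (Set.Iio (N.G k))).preimage hc

theorem ConstRec.compactSpace (H : N.ConstRec d a) : CompactSpace N.K := by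
  rw [← isCompact_iff_compactSpace]
  refine (isCompact_univ_pi fun _ : ℕ => (Set.finite_Iic a).isCompact).of_isClosed_subset
    isClosed_K fun x hx i _ => (H.mem_K_iff.1 hx).1 i

theorem ConstRec.continuous_monna (H : N.ConstRec d a) (hβ : IsConstRoot d a β) :
    Continuous (N.monna β) := by
  have hβ1 := hβ.one_lt
  have hg : Summable fun j : ℕ => (a : ℝ) / β ^ (j + 1) := by
    have h := (summable_geometric_of_lt_one (inv_nonneg.2 (by linarith : (0 : ℝ) ≤ β))
      (inv_lt_one_of_one_lt₀ hβ1)).mul_left ((a : ℝ) / β)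
    refine h.congr fun j => ?_
    rw [inv_pow, ← div_eq_mul_inv, div_div, pow_succ, mul_comm β]
  refine continuous_tsum (fun j => ?_) hg fun j x => ?_
  · have : Continuous fun x : N.K => x.1 j := (continuous_apply j).comp continuous_subtype_val
    exact (continuous_of_discreteTopology.comp this).div_const _
  · rw [Real.norm_of_nonneg (by positivity)]
    have : (x.1 j : ℝ) ≤ a := by exact_mod_cast (H.mem_K_iff.1 x.2).1 j
    exact div_le_div_of_nonneg_right this (by positivity)

theorem isClosed_cylinder {k : ℕ} (w : Fin k → ℕ) : IsClosed (N.cylinder w) := by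
  have : N.cylinder w = ⋂ i : Fin k, {x : N.K | x.1 i = w i} := by ext; simp [cylinder]
  rw [this]
  refine isClosed_iInter fun i => ?_
  have hc : Continuous fun x : N.K => x.1 i :=
    (continuous_apply (i : ℕ)).comp continuous_subtype_val
  exact isClosed_eq hc continuous_const

theorem ConstRec.measurableSet_monna_cylinder (H : N.ConstRec d a) (hβ : IsConstRoot d a β)
    {k : ℕ} (w : Fin k → ℕ) : MeasurableSet (N.monna β '' N.cylinder w) := by
  have := H.compactSpace
  exact ((isClosed_cylinder w).isCompact.image (H.continuous_monna hβ)).measurableSet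

/-- If every `freeSet` has at most the expected measure then it has the expected measure. -/
theorem ConstRec.measureReal_freeSet_of_le (H : N.ConstRec d a) (hβ : IsConstRoot d a β)
    {μ : Measure N.K} [IsProbabilityMeasure μ]
    (hμ : ∀ z s, μ.real (N.freeSet a z s) ≤ a / β ^ (s + 1)) {z : ℕ → ℕ} (hz : z ∈ N.K) (s : ℕ) :
    μ.real (N.freeSet a z s) = a / β ^ (s + 1) := by
  have hβ1 := hβ.one_lt
  have hzK := H.mem_K_iff.1 hz
  induction s using Nat.strong_induction_on with
  | _ s ih =>
  have short : ∀ j i, (∀ l < i, z (j + l) = a) → i < d := by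
    intro j i h
    by_contra! hi
    obtain ⟨l, hl, h'⟩ := hzK.2 j
    rw [h l (by omega)] at h'
    exact lt_irrefl _ h'
  -- This free set is a piece of a partition of the whole space, or of the shorter free set at `n`.
  -- The total is known and equals the sum of the upper bounds, so every piece attains its bound.
  rcases run_decomp hzK.1 s with h | ⟨n, i, rfl, hn, hi⟩
  · have hsd : s < d := short 0 s (by simpa using h)
    have e := congrArg ENNReal.toReal (H.measure_univ_eq_sum μ z)
    rw [measure_univ, ENNReal.toReal_one, ENNReal.toReal_sum fun m _ => measure_ne_top _ _,
      ← hβ.sum_eq, eq_comm] at e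
    have e1 := (Finset.sum_eq_sum_iff_of_le fun m _ => hμ (padWith a z 0) m).1 e s
      (Finset.mem_range.2 hsd)
    rw [← e1]
    exact congrArg μ.real (freeSet_congr fun l hl => by simp [padWith, h l hl])
  · have hid : i < d := short (n + 1) i hi
    have e := congrArg ENNReal.toReal (H.measure_freeSet μ z n)
    rw [← Finset.sum_product', ENNReal.toReal_sum fun m _ => measure_ne_top _ _] at e
    have e0 : (μ (N.freeSet a z n)).toReal = ∑ p ∈ Finset.range a ×ˢ Finset.range d,
        (a : ℝ) / β ^ (n + 1 + p.2 + 1) := by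
      rw [Finset.sum_product]
      have : ∑ m ∈ Finset.range d, (a : ℝ) / β ^ (n + 1 + m + 1) = 1 / β ^ (n + 1) := by
        rw [← hβ.sum_eq, Finset.sum_div]
        refine Finset.sum_congr rfl fun m _ => ?_
        rw [div_div, ← pow_add]
        congr 2
        omega
      simp only [this, Finset.sum_const, Finset.card_range, nsmul_eq_mul]
      rw [mul_one_div]
      exact ih n (by omega)
    rw [e0, eq_comm] at e
    have e1 := (Finset.sum_eq_sum_iff_of_le fun p _ =>
      hμ (padWith a (Function.update z n p.1) (n + 1)) (n + 1 + p.2)).1 e (z n, i)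
      (Finset.mem_product.2 ⟨Finset.mem_range.2 hn, Finset.mem_range.2 hid⟩)
    dsimp only at e1
    rw [← e1]
    refine congrArg μ.real (freeSet_congr fun l hl => ?_)
    rw [Function.update_eq_self, padWith]
    split_ifs with h
    · rfl
    · have := hi (l - (n + 1)) (by omega)
      rwa [show n + 1 + (l - (n + 1)) = l by omega] at this

end NumerationSystem

theorem lemma4p2 (N : NumerationSystem) (d : ℕ) (hd : 1 ≤ d) (c : ℕ → ℕ) (a : ℕ) (ha : 1 ≤ a)
    (hc : ∀ j, j < d → c j = a) (hG : N.IsLinearRecurrence d c)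
    (β : ℝ) (hβ : IsCharacteristicRoot d c β) :
    ∃ μ : Measure N.K, IsUniqueInvariantMeasure N.odometer μ ∧
      ∀ (k : ℕ) (w : Fin k → ℕ),
        MeasurableSet (N.monna β '' N.cylinder w) ∧
          μ (N.cylinder w) = volume (N.monna β '' N.cylinder w) := by
  have H := hG.constRec hd ha hc
  have hr := H.isConstRoot hc hβ
  have hβ1 := hr.one_lt
  obtain ⟨μ, hμ, hle⟩ := H.exists_measure_le_image hr
  have hreal : ∀ z ∈ N.K, ∀ s, μ.real (N.freeSet a z s) = a / β ^ (s + 1) := fun z hz s =>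
    H.measureReal_freeSet_of_le hr (fun z s => ENNReal.toReal_le_of_le_ofReal (by positivity)
      ((hle _ (NumerationSystem.measurableSet_freeSet _ _ _)).trans
        (H.volume_monna_freeSet_le hr z s))) hz s
  have hval : ∀ z ∈ N.K, ∀ s, μ (N.freeSet a z s) = ENNReal.ofReal (a / β ^ (s + 1)) :=
    fun z hz s => by rw [← hreal z hz s, ofReal_measureReal]
  refine ⟨μ, ⟨hμ, H.measurePreserving_odometer _ hval, fun ν hν hinv => ?_⟩, fun k w =>
    ⟨H.measurableSet_monna_cylinder hr w, ?_⟩⟩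
  · refine H.measure_ext fun z hz s _ => ?_
    rw [hval z hz, ← H.measureReal_freeSet_of_invariant hr hinv hz s, ofReal_measureReal]
  · set z : ℕ → ℕ := fun i => if h : i < k then w ⟨i, h⟩ else 0
    have hcyl : N.cylinder w = N.prefixSet z k := by
      ext x
      refine ⟨fun h i hi => ?_, fun h i => ?_⟩
      · rw [h ⟨i, hi⟩]; simp [z, hi]
      · rw [h i i.2]; simp [z]
    rw [hcyl]
    refine le_antisymm (hle _ (NumerationSystem.measurableSet_prefixSet _ _)) ?_
    rw [H.measure_prefixSet μ z k, H.prefixSet_eq_iUnion, Set.image_iUnion₂]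
    refine (measure_biUnion_finset_le _ _).trans (Finset.sum_le_sum fun m _ => ?_)
    -- The mass formula needs an admissible prefix; a nonempty piece supplies one through any of its
    -- points.
    rcases (N.freeSet a (NumerationSystem.padWith a z k) (k + m)).eq_empty_or_nonempty
      with h | ⟨x, hx⟩
    · simp [h]
    · refine (H.volume_monna_freeSet_le hr _ _).trans (le_of_eq ?_)
      rw [← hval x.1 x.2]
      exact congrArg μ (NumerationSystem.freeSet_congr hx.1)
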